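/- **Atomic normalisation.** Let $\mathsf{At}$ consist of countably many propositional atoms together with the units $\bot,\top$ (treated as atoms), and let formulas be built from $\mathsf{At}$ with $\land,\lor,\to$ and co-implication $\mapsfrom$. Let $\Theta$ be a set of formulas, $\Theta^{Sub}$ the set of all subformulas of its members, and $\alpha:\Theta^{Sub}\to\mathsf{At}$ an atomic mapping, i.e. an injective map with $\alpha(p)=p$ for every atom $p\in\Theta^{Sub}$; write $p^{\phi}=\alpha(\phi)$. A signed atom $+p$ is read as a proof of $p$, and $-p$ as a refutation of $p$. The simulation base $\mathcal U$ given by $\alpha$ has the following natural deduction rules, for all $\phi,\psi$ such that the formulas shown belong to $\Theta^{Sub}$ and all signed atoms $K$ (premises before $\Rightarrow$; discharged assumptions in brackets): * axioms $\Rightarrow +\top$ and $\Rightarrow -\bot$; explosion rules $+\bot\Rightarrow K$ and $-\top\Rightarrow K$; $PR(\pm)$: $+p^{\phi},\,-p^{\phi}\Rightarrow K$; * for $(C;A,B)$ among $(+p^{\phi\land\psi};+p^\phi,+p^\psi)$, $(-p^{\phi\lor\psi};-p^\phi,-p^\psi)$, $(+p^{\phi\mapsfrom\psi};+p^\phi,-p^\psi)$,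 $(-p^{\phi\to\psi};+p^\phi,-p^\psi)$: the I-rule $A,B\Rightarrow C$ and the E-rules $C\Rightarrow A$ and $C\Rightarrow B$; * for $(C;A,B)$ among $(+p^{\phi\lor\psi};+p^\phi,+p^\psi)$, $(-p^{\phi\land\psi};-p^\phi,-p^\psi)$: the I-rules $A\Rightarrow C$ and $B\Rightarrow C$ and the E-rule $C,\ [A]K,\ [B]K\Rightarrow K$; * for $(C;A,B)$ among $(+p^{\phi\to\psi};+p^\phi,+p^\psi)$, $(-p^{\phi\mapsfrom\psi};-p^\psi,-p^\phi)$: the I-rule $[A]B\Rightarrow C$ and the E-rule $C,A\Rightarrow B$. In each E-rule $C$ is the major premise; the two premises $K$ of the case-elimination rule are its minor premises. Each rule application in a derivation carries the name of its rule; a discharge may be vacuous. A derivation is *from assumptions $\Gamma$ and counterassumptions $\Delta$* if every undischarged top occurrence is $+a$ with $a\in\Gamma$ or $-a$ with $a\in\Delta$. A *maximal segment* is a sequence of $n\ge 1$ occurrences of one signed atom in a derivation, where the first is the conclusion of an I-rule, the last is the major premise of an E-rule, and each one but the last is a minor premise of an application of a case-elimination rule whose conclusion is the next one. Its length is $n$,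 and its degree is the number of connectives of the formula $\phi$ whose atom $p^{\phi}$ occurs in it. The *inductive value* of a derivation is $\langle d,s\rangle$, where $d$ is the highest degree of a maximal segment and $s$ is the sum of the lengths of the maximal segments of degree $d$ ($\langle 0,0\rangle$ if there are none). A derivation is *normal* if its inductive value is $\langle 0,0\rangle$. *Reduction* is the reflexive transitive closure of the application to subderivations of the following steps: 1. proper reductions, which remove an I-rule immediately followed by the corresponding E-rule. If a derivation of $C$ ends with the I-rule, then $A,B\Rightarrow C\Rightarrow A$ (or $B$) is replaced by the given derivation of $A$ (or $B$); and for discharging rules the derivation of the discharged signed atom is put in place of the discharged assumptions; 2. permutative reductions, which move an E-rule whose major premise is the conclusion of a case-elimination up above both of its minor premises; 3. expansions of $PR$ and explosion rules. An application with conclusion $C$ is replaced by applications, with the same premises, whose conclusions are the premises of an I-rule for $C$, followed by that I-rule (the rule $A\Rightarrow C$ if $C$ is $+p^{\phi\lor\psi}$ or $-p^{\phi\land\psi}$). An application of $PR$ to $\pm p^{\chi}$ with compound $\chi$ is replaced as follows: for $\chi=\phi\land\psi$ or $\phi\lor\psi$, by a case-elimination on the signed atom $-p^{\phi\land\psi}$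 or $+p^{\phi\lor\psi}$, each case being closed by $PR$ applied to the discharged assumption and the corresponding component of the other premise; for $\chi=\phi\to\psi$, by $PR$ on $\pm p^{\psi}$, where $+p^\psi$ comes from $+p^{\phi\to\psi}$ and the $+p^{\phi}$ extracted from $-p^{\phi\to\psi}$, and $-p^{\psi}$ is extracted from $-p^{\phi\to\psi}$; for $\chi=\phi\mapsfrom\psi$, by $PR$ on $\pm p^{\phi}$, where $+p^{\phi}$ is extracted from $+p^{\phi\mapsfrom\psi}$, and $-p^{\phi}$ comes from $-p^{\phi\mapsfrom\psi}$ and the $-p^{\psi}$ extracted from $+p^{\phi\mapsfrom\psi}$; 4. if the conclusion of an application of $PR$ or an explosion rule is a premise of another such application with conclusion $K$, both are replaced by the upper one with its conclusion changed to $K$. **Theorem.** For all sets $\Gamma,\Delta\subseteq\mathsf{At}$ and every signed atom $J$, every derivation $\Pi$ of $J$ in $\mathcal U$ from assumptions $\Gamma$ and counterassumptions $\Delta$ reduces to a normal derivation $\Pi'$ of $J$ in $\mathcal U$ from assumptions $\Gamma$ and counterassumptions $\Delta$. -/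

import Mathlib

namespace BPR

/-- Basic sentences: countably many atomic propositions together with the two units, which are
treated as atoms. -/
inductive Atom : Type
  | prop (n : ℕ)
  | bot
  | top

/-- Formulas over the basic sentences; `coimp φ ψ` is the co-implication `φ ↤ ψ`. -/
inductive Formula : Type
  | atom (a : Atom)
  | and (φ ψ : Formula)
  | or (φ ψ : Formula)
  | imp (φ ψ : Formula)
  | coimp (φ ψ : Formula)

namespace Formula

/-- The degree of a formula (number of connectives; atoms, including the units, have degree 0). -/
def degree : Formula → ℕ
  | atom _ => 0
  | and φ ψ => φ.degree + ψ.degree + 1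
  | or φ ψ => φ.degree + ψ.degree + 1
  | imp φ ψ => φ.degree + ψ.degree + 1
  | coimp φ ψ => φ.degree + ψ.degree + 1

/-- The set of subformulas of a formula (the formula itself included). -/
def subformulas : Formula → Set Formula
  | atom a => {atom a}
  | and φ ψ => insert (and φ ψ) (φ.subformulas ∪ ψ.subformulas)
  | or φ ψ => insert (or φ ψ) (φ.subformulas ∪ ψ.subformulas)
  | imp φ ψ => insert (imp φ ψ) (φ.subformulas ∪ ψ.subformulas)
  | coimp φ ψ => insert (coimp φ ψ) (φ.subformulas ∪ ψ.subformulas)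

end Formula

/-- The set of all subformulas of members of `Θ`. -/
def Sub (Θ : Set Formula) : Set Formula := {φ | ∃ ψ ∈ Θ, φ ∈ ψ.subformulas}

/-- `α` is an atomic mapping on the set `S` of formulas: it is injective on `S` and fixes the atoms
in `S`. Values of `α` outside `S` are never used. -/
structure IsAtomicMapping (S : Set Formula) (α : Formula → Atom) : Prop where
  injOn : Set.InjOn α S
  fixes : ∀ a : Atom, Formula.atom a ∈ S → α (Formula.atom a) = a

/-- An atom together with the kind of line above it: `pos a` is a proof of `a` (single line, or an
assumption), `neg a` is a refutation of `a` (double line, or a counterassumption). -/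
inductive SignedAtom : Type
  | pos (a : Atom)
  | neg (a : Atom)

open SignedAtom

/-! ### The rules of the simulation base

`α φ` is the atom `p^φ`. The following tables list the instances of the logical rules for the
formulas in `S` according to their shape. -/

section Rules

variable (S : Set Formula) (α : Formula → Atom)

/-- `IsPair C A B`: `C` is introduced from the two premises `A`, `B`, and is eliminated to `A` and
to `B`. These are the rules `I∧(+)`, `E₁∧(+)`, `E₂∧(+)`; `I∨(-)`, `E₁∨(-)`, `E₂∨(-)`;
`I↤(+)`, `E₁↤(+)`, `E₂↤(+)`; `I→(-)`, `E₁→(-)`, `E₂→(-)`. -/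
inductive IsPair : SignedAtom → SignedAtom → SignedAtom → Prop
  | and_pos (φ ψ : Formula) (h : φ.and ψ ∈ S) :
      IsPair (pos (α (φ.and ψ))) (pos (α φ)) (pos (α ψ))
  | or_neg (φ ψ : Formula) (h : φ.or ψ ∈ S) :
      IsPair (neg (α (φ.or ψ))) (neg (α φ)) (neg (α ψ))
  | coimp_pos (φ ψ : Formula) (h : φ.coimp ψ ∈ S) :
      IsPair (pos (α (φ.coimp ψ))) (pos (α φ)) (neg (α ψ))
  | imp_neg (φ ψ : Formula) (h : φ.imp ψ ∈ S) :
      IsPair (neg (α (φ.imp ψ))) (pos (α φ)) (neg (α ψ))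

/-- `IsCase C A B`: `C` is introduced from `A` and from `B`, and is eliminated by cases
discharging `A` and `B`. These are the rules `I₁∨(+)`, `I₂∨(+)`, `E∨(+)`;
`I₁∧(-)`, `I₂∧(-)`, `E∧(-)`. -/
inductive IsCase : SignedAtom → SignedAtom → SignedAtom → Prop
  | or_pos (φ ψ : Formula) (h : φ.or ψ ∈ S) :
      IsCase (pos (α (φ.or ψ))) (pos (α φ)) (pos (α ψ))
  | and_neg (φ ψ : Formula) (h : φ.and ψ ∈ S) :
      IsCase (neg (α (φ.and ψ))) (neg (α φ)) (neg (α ψ))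

/-- `IsCond C A B`: `C` is introduced from `B` discharging `A`, and is eliminated with minor
premise `A` to `B`. These are the rules `I→(+)`, `E→(+)`; `I↤(-)`, `E↤(-)`. -/
inductive IsCond : SignedAtom → SignedAtom → SignedAtom → Prop
  | imp_pos (φ ψ : Formula) (h : φ.imp ψ ∈ S) :
      IsCond (pos (α (φ.imp ψ))) (pos (α φ)) (pos (α ψ))
  | coimp_neg (φ ψ : Formula) (h : φ.coimp ψ ∈ S) :
      IsCond (neg (α (φ.coimp ψ))) (neg (α ψ)) (neg (α φ))

end Rules

/-- The premises of `⊥(+)` and of `⊤(-)`: a proof of `⊥` and a refutation of `⊤`. -/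
inductive IsAbsurd : SignedAtom → Prop
  | bot_pos : IsAbsurd (pos Atom.bot)
  | top_neg : IsAbsurd (neg Atom.top)

/-- The undischarged premises allowed by assumptions `Γ` and counterassumptions `Δ`. -/
def IsPremise (Γ Δ : Set Atom) : SignedAtom → Prop
  | pos a => a ∈ Γ
  | neg a => a ∈ Δ

/-- Positions in a list of discharged assumption classes. -/
inductive Var : List SignedAtom → SignedAtom → Type
  | zero {c : List SignedAtom} {J : SignedAtom} : Var (J :: c) J
  | succ {c : List SignedAtom} {J K : SignedAtom} : Var c J → Var (K :: c) J

/-- `Deriv S α Γ Δ c J`: derivations of `J` in the simulation base given by the atomic mapping `α`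
on `S`, all of whose undischarged top occurrences are assumptions in `Γ` or counterassumptions in
`Δ`, apart from those belonging to the classes listed in `c`, which are to be discharged by a rule
application further below. A derivation from `Γ; Δ` is one with `c = []`. The discharging rules
`condI` and `caseE` bind a new class; which occurrences of the right shape (possibly none) belong to
the class is part of the derivation. The conclusion `K` of `caseE`, `absurd` and `pr` is an
arbitrary signed atom. -/
inductive Deriv (S : Set Formula) (α : Formula → Atom) (Γ Δ : Set Atom) :
    List SignedAtom → SignedAtom → Type
  | premise {c : List SignedAtom} {J : SignedAtom} (h : IsPremise Γ Δ J) : Deriv S α Γ Δ c J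
  | var {c : List SignedAtom} {J : SignedAtom} (x : Var c J) : Deriv S α Γ Δ c J
  /-- The axiom `⊤(+)`. -/
  | topPos {c : List SignedAtom} : Deriv S α Γ Δ c (pos Atom.top)
  /-- The axiom `⊥(-)`. -/
  | botNeg {c : List SignedAtom} : Deriv S α Γ Δ c (neg Atom.bot)
  | pairI {c : List SignedAtom} {C A B : SignedAtom} (h : IsPair S α C A B)
      (D : Deriv S α Γ Δ c A) (E : Deriv S α Γ Δ c B) : Deriv S α Γ Δ c C
  | pairE₁ {c : List SignedAtom} {C A B : SignedAtom} (h : IsPair S α C A B)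
      (D : Deriv S α Γ Δ c C) : Deriv S α Γ Δ c A
  | pairE₂ {c : List SignedAtom} {C A B : SignedAtom} (h : IsPair S α C A B)
      (D : Deriv S α Γ Δ c C) : Deriv S α Γ Δ c B
  | condI {c : List SignedAtom} {C A B : SignedAtom} (h : IsCond S α C A B)
      (D : Deriv S α Γ Δ (A :: c) B) : Deriv S α Γ Δ c C
  | condE {c : List SignedAtom} {C A B : SignedAtom} (h : IsCond S α C A B)
      (D : Deriv S α Γ Δ c C) (E : Deriv S α Γ Δ c A) : Deriv S α Γ Δ c B
  | caseI₁ {c : List SignedAtom} {C A B : SignedAtom} (h : IsCase S α C A B)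
      (D : Deriv S α Γ Δ c A) : Deriv S α Γ Δ c C
  | caseI₂ {c : List SignedAtom} {C A B : SignedAtom} (h : IsCase S α C A B)
      (D : Deriv S α Γ Δ c B) : Deriv S α Γ Δ c C
  | caseE {c : List SignedAtom} {C A B K : SignedAtom} (h : IsCase S α C A B)
      (D : Deriv S α Γ Δ c C) (E : Deriv S α Γ Δ (A :: c) K) (F : Deriv S α Γ Δ (B :: c) K) :
      Deriv S α Γ Δ c K
  /-- The rules `⊥(+)` and `⊤(-)`. -/
  | absurd {c : List SignedAtom} {N : SignedAtom} (h : IsAbsurd N) (D : Deriv S α Γ Δ c N)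
      (K : SignedAtom) : Deriv S α Γ Δ c K
  /-- The rules `PR(+)` (for `K = pos q`) and `PR(-)` (for `K = neg q`). -/
  | pr {c : List SignedAtom} {φ : Formula} (h : φ ∈ S) (D : Deriv S α Γ Δ c (pos (α φ)))
      (E : Deriv S α Γ Δ c (neg (α φ))) (K : SignedAtom) : Deriv S α Γ Δ c K

/-! ### Substitution of derivations for classes of assumptions -/

/-- Renamings of assumption classes. -/
def Ren (c c' : List SignedAtom) : Type := ∀ J : SignedAtom, Var c J → Var c' J

/-- Extension of a renaming under a discharging rule. -/
def Ren.lift {c c' : List SignedAtom} (ρ : Ren c c') (K : SignedAtom) : Ren (K :: c) (K :: c')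
  | _, Var.zero => Var.zero
  | _, Var.succ x => Var.succ (ρ _ x)

namespace Deriv

variable {S : Set Formula} {α : Formula → Atom} {Γ Δ : Set Atom}

/-- Renaming of the assumption classes of a derivation. -/
def rename {c c' : List SignedAtom} {J : SignedAtom} (ρ : Ren c c') :
    Deriv S α Γ Δ c J → Deriv S α Γ Δ c' J
  | premise h => premise h
  | var x => var (ρ _ x)
  | topPos => topPos
  | botNeg => botNeg
  | pairI h D E => pairI h (D.rename ρ) (E.rename ρ)
  | pairE₁ h D => pairE₁ h (D.rename ρ)
  | pairE₂ h D => pairE₂ h (D.rename ρ)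
  | condI h D => condI h (D.rename (ρ.lift _))
  | condE h D E => condE h (D.rename ρ) (E.rename ρ)
  | caseI₁ h D => caseI₁ h (D.rename ρ)
  | caseI₂ h D => caseI₂ h (D.rename ρ)
  | caseE h D E F => caseE h (D.rename ρ) (E.rename (ρ.lift _)) (F.rename (ρ.lift _))
  | absurd h D K => absurd h (D.rename ρ) K
  | pr h D E K => pr h (D.rename ρ) (E.rename ρ) K

/-- The same derivation, placed above a rule application that discharges a class `K` to which none
of its top occurrences belongs. -/
def weaken {c : List SignedAtom} {J : SignedAtom} (K : SignedAtom) (D : Deriv S α Γ Δ c J) :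
    Deriv S α Γ Δ (K :: c) J :=
  D.rename (fun _ x => Var.succ x)

/-- The same for a derivation in which a class `A` is already discharged. -/
def weaken₁ {c : List SignedAtom} {A J : SignedAtom} (K : SignedAtom)
    (D : Deriv S α Γ Δ (A :: c) J) : Deriv S α Γ Δ (A :: K :: c) J :=
  D.rename (Ren.lift (fun _ x => Var.succ x) A)

end Deriv

/-- Simultaneous substitutions of derivations for assumption classes. -/
def Subst (S : Set Formula) (α : Formula → Atom) (Γ Δ : Set Atom) (c c' : List SignedAtom) : Type :=
  ∀ J : SignedAtom, Var c J → Deriv S α Γ Δ c' J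

/-- Extension of a substitution under a discharging rule. -/
def Subst.lift {S : Set Formula} {α : Formula → Atom} {Γ Δ : Set Atom} {c c' : List SignedAtom}
    (σ : Subst S α Γ Δ c c') (K : SignedAtom) : Subst S α Γ Δ (K :: c) (K :: c')
  | _, Var.zero => Deriv.var Var.zero
  | _, Var.succ x => (σ _ x).weaken K

/-- The substitution replacing the last class by the derivation `E`, fixing the others. -/
def Subst.single {S : Set Formula} {α : Formula → Atom} {Γ Δ : Set Atom} {c : List SignedAtom}
    {A : SignedAtom} (E : Deriv S α Γ Δ c A) : Subst S α Γ Δ (A :: c) c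
  | _, Var.zero => E
  | _, Var.succ x => Deriv.var x

namespace Deriv

variable {S : Set Formula} {α : Formula → Atom} {Γ Δ : Set Atom}

/-- Simultaneous substitution in a derivation. -/
def subst {c c' : List SignedAtom} {J : SignedAtom} (σ : Subst S α Γ Δ c c') :
    Deriv S α Γ Δ c J → Deriv S α Γ Δ c' J
  | premise h => premise h
  | var x => σ _ x
  | topPos => topPos
  | botNeg => botNeg
  | pairI h D E => pairI h (D.subst σ) (E.subst σ)
  | pairE₁ h D => pairE₁ h (D.subst σ)
  | pairE₂ h D => pairE₂ h (D.subst σ)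
  | condI h D => condI h (D.subst (σ.lift _))
  | condE h D E => condE h (D.subst σ) (E.subst σ)
  | caseI₁ h D => caseI₁ h (D.subst σ)
  | caseI₂ h D => caseI₂ h (D.subst σ)
  | caseE h D E F => caseE h (D.subst σ) (E.subst (σ.lift _)) (F.subst (σ.lift _))
  | absurd h D K => absurd h (D.subst σ) K
  | pr h D E K => pr h (D.subst σ) (E.subst σ) K

/-- `D.plug E`: the derivation `E` of `A` is put above all occurrences in the last assumption
class `[A]` of `D`. -/
def plug {c : List SignedAtom} {A J : SignedAtom} (D : Deriv S α Γ Δ (A :: c) J)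
    (E : Deriv S α Γ Δ c A) : Deriv S α Γ Δ c J :=
  D.subst (Subst.single E)

end Deriv

/-! ### Reductions -/

section Reduction

variable {S : Set Formula} {α : Formula → Atom} {Γ Δ : Set Atom}

open Deriv

/-- Proper reductions: an introduction immediately followed by an elimination. -/
inductive ProperRed : ∀ {c : List SignedAtom} {J : SignedAtom},
    Deriv S α Γ Δ c J → Deriv S α Γ Δ c J → Prop
  | pair₁ {c : List SignedAtom} {C A B : SignedAtom} (h : IsPair S α C A B)
      (D : Deriv S α Γ Δ c A) (E : Deriv S α Γ Δ c B) :
      ProperRed (pairE₁ h (pairI h D E)) D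
  | pair₂ {c : List SignedAtom} {C A B : SignedAtom} (h : IsPair S α C A B)
      (D : Deriv S α Γ Δ c A) (E : Deriv S α Γ Δ c B) :
      ProperRed (pairE₂ h (pairI h D E)) E
  | cond {c : List SignedAtom} {C A B : SignedAtom} (h : IsCond S α C A B)
      (D : Deriv S α Γ Δ (A :: c) B) (E : Deriv S α Γ Δ c A) :
      ProperRed (condE h (condI h D) E) (D.plug E)
  | case₁ {c : List SignedAtom} {C A B K : SignedAtom} (h : IsCase S α C A B)
      (D : Deriv S α Γ Δ c A) (E : Deriv S α Γ Δ (A :: c) K) (F : Deriv S α Γ Δ (B :: c) K) :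
      ProperRed (caseE h (caseI₁ h D) E F) (E.plug D)
  | case₂ {c : List SignedAtom} {C A B K : SignedAtom} (h : IsCase S α C A B)
      (D : Deriv S α Γ Δ c B) (E : Deriv S α Γ Δ (A :: c) K) (F : Deriv S α Γ Δ (B :: c) K) :
      ProperRed (caseE h (caseI₂ h D) E F) (F.plug D)

/-- Permutative reductions: the major premise of an elimination is the conclusion of `E∨(+)` or
`E∧(-)`; the elimination is moved up to the minor premises. -/
inductive PermRed : ∀ {c : List SignedAtom} {J : SignedAtom},
    Deriv S α Γ Δ c J → Deriv S α Γ Δ c J → Prop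
  | pair₁ {c : List SignedAtom} {C A B C' A' B' : SignedAtom} (h : IsCase S α C A B)
      (h' : IsPair S α C' A' B') (D : Deriv S α Γ Δ c C) (E : Deriv S α Γ Δ (A :: c) C')
      (F : Deriv S α Γ Δ (B :: c) C') :
      PermRed (pairE₁ h' (caseE h D E F)) (caseE h D (pairE₁ h' E) (pairE₁ h' F))
  | pair₂ {c : List SignedAtom} {C A B C' A' B' : SignedAtom} (h : IsCase S α C A B)
      (h' : IsPair S α C' A' B') (D : Deriv S α Γ Δ c C) (E : Deriv S α Γ Δ (A :: c) C')
      (F : Deriv S α Γ Δ (B :: c) C') :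
      PermRed (pairE₂ h' (caseE h D E F)) (caseE h D (pairE₂ h' E) (pairE₂ h' F))
  | cond {c : List SignedAtom} {C A B C' A' B' : SignedAtom} (h : IsCase S α C A B)
      (h' : IsCond S α C' A' B') (D : Deriv S α Γ Δ c C) (E : Deriv S α Γ Δ (A :: c) C')
      (F : Deriv S α Γ Δ (B :: c) C') (G : Deriv S α Γ Δ c A') :
      PermRed (condE h' (caseE h D E F) G)
        (caseE h D (condE h' E (G.weaken A)) (condE h' F (G.weaken B)))
  | case {c : List SignedAtom} {C A B C' A' B' K : SignedAtom} (h : IsCase S α C A B)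
      (h' : IsCase S α C' A' B') (D : Deriv S α Γ Δ c C) (E : Deriv S α Γ Δ (A :: c) C')
      (F : Deriv S α Γ Δ (B :: c) C') (G : Deriv S α Γ Δ (A' :: c) K)
      (H : Deriv S α Γ Δ (B' :: c) K) :
      PermRed (caseE h' (caseE h D E F) G H)
        (caseE h D (caseE h' E (G.weaken₁ A) (H.weaken₁ A))
          (caseE h' F (G.weaken₁ B) (H.weaken₁ B)))

/-- Reductions decreasing the degree of premises and conclusions of `PR(+)`, `PR(-)`, `⊥(+)` and
`⊤(-)`. -/
inductive ExpandRed : ∀ {c : List SignedAtom} {J : SignedAtom},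
    Deriv S α Γ Δ c J → Deriv S α Γ Δ c J → Prop
  | premise_and {c : List SignedAtom} {φ ψ : Formula} (h : φ.and ψ ∈ S) (hφ : φ ∈ S) (hψ : ψ ∈ S)
      (D : Deriv S α Γ Δ c (pos (α (φ.and ψ)))) (E : Deriv S α Γ Δ c (neg (α (φ.and ψ))))
      (K : SignedAtom) :
      ExpandRed (pr h D E K)
        (caseE (IsCase.and_neg φ ψ h) E
          (pr hφ (pairE₁ (IsPair.and_pos φ ψ h) (D.weaken _)) (var Var.zero) K)
          (pr hψ (pairE₂ (IsPair.and_pos φ ψ h) (D.weaken _)) (var Var.zero) K))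
  | premise_or {c : List SignedAtom} {φ ψ : Formula} (h : φ.or ψ ∈ S) (hφ : φ ∈ S) (hψ : ψ ∈ S)
      (D : Deriv S α Γ Δ c (pos (α (φ.or ψ)))) (E : Deriv S α Γ Δ c (neg (α (φ.or ψ))))
      (K : SignedAtom) :
      ExpandRed (pr h D E K)
        (caseE (IsCase.or_pos φ ψ h) D
          (pr hφ (var Var.zero) (pairE₁ (IsPair.or_neg φ ψ h) (E.weaken _)) K)
          (pr hψ (var Var.zero) (pairE₂ (IsPair.or_neg φ ψ h) (E.weaken _)) K))
  | premise_imp {c : List SignedAtom} {φ ψ : Formula} (h : φ.imp ψ ∈ S) (hψ : ψ ∈ S)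
      (D : Deriv S α Γ Δ c (pos (α (φ.imp ψ)))) (E : Deriv S α Γ Δ c (neg (α (φ.imp ψ))))
      (K : SignedAtom) :
      ExpandRed (pr h D E K)
        (pr hψ (condE (IsCond.imp_pos φ ψ h) D (pairE₁ (IsPair.imp_neg φ ψ h) E))
          (pairE₂ (IsPair.imp_neg φ ψ h) E) K)
  | premise_coimp {c : List SignedAtom} {φ ψ : Formula} (h : φ.coimp ψ ∈ S) (hφ : φ ∈ S)
      (D : Deriv S α Γ Δ c (pos (α (φ.coimp ψ)))) (E : Deriv S α Γ Δ c (neg (α (φ.coimp ψ))))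
      (K : SignedAtom) :
      ExpandRed (pr h D E K)
        (pr hφ (pairE₁ (IsPair.coimp_pos φ ψ h) D)
          (condE (IsCond.coimp_neg φ ψ h) E (pairE₂ (IsPair.coimp_pos φ ψ h) D)) K)
  | pr_pair {c : List SignedAtom} {φ : Formula} {C A B : SignedAtom} (h : φ ∈ S)
      (hC : IsPair S α C A B) (D : Deriv S α Γ Δ c (pos (α φ)))
      (E : Deriv S α Γ Δ c (neg (α φ))) :
      ExpandRed (pr h D E C) (pairI hC (pr h D E A) (pr h D E B))
  | pr_case {c : List SignedAtom} {φ : Formula} {C A B : SignedAtom} (h : φ ∈ S)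
      (hC : IsCase S α C A B) (D : Deriv S α Γ Δ c (pos (α φ)))
      (E : Deriv S α Γ Δ c (neg (α φ))) :
      ExpandRed (pr h D E C) (caseI₁ hC (pr h D E A))
  | pr_cond {c : List SignedAtom} {φ : Formula} {C A B : SignedAtom} (h : φ ∈ S)
      (hC : IsCond S α C A B) (D : Deriv S α Γ Δ c (pos (α φ)))
      (E : Deriv S α Γ Δ c (neg (α φ))) :
      ExpandRed (pr h D E C) (condI hC (pr h (D.weaken A) (E.weaken A) B))
  | absurd_pair {c : List SignedAtom} {N C A B : SignedAtom} (h : IsAbsurd N)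
      (hC : IsPair S α C A B) (D : Deriv S α Γ Δ c N) :
      ExpandRed (absurd h D C) (pairI hC (absurd h D A) (absurd h D B))
  | absurd_case {c : List SignedAtom} {N C A B : SignedAtom} (h : IsAbsurd N)
      (hC : IsCase S α C A B) (D : Deriv S α Γ Δ c N) :
      ExpandRed (absurd h D C) (caseI₁ hC (absurd h D A))
  | absurd_cond {c : List SignedAtom} {N C A B : SignedAtom} (h : IsAbsurd N)
      (hC : IsCond S α C A B) (D : Deriv S α Γ Δ c N) :
      ExpandRed (absurd h D C) (condI hC (absurd h (D.weaken A) B))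

/-- Reductions deleting one of two consecutive applications of `PR(+)`, `PR(-)`, `⊥(+)`, `⊤(-)`. -/
inductive DeleteRed : ∀ {c : List SignedAtom} {J : SignedAtom},
    Deriv S α Γ Δ c J → Deriv S α Γ Δ c J → Prop
  | pr_pr₁ {c : List SignedAtom} {φ ψ : Formula} (h : φ ∈ S) (h' : ψ ∈ S)
      (D : Deriv S α Γ Δ c (pos (α φ))) (E : Deriv S α Γ Δ c (neg (α φ)))
      (F : Deriv S α Γ Δ c (neg (α ψ))) (K : SignedAtom) :
      DeleteRed (pr h' (pr h D E (pos (α ψ))) F K) (pr h D E K)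
  | pr_pr₂ {c : List SignedAtom} {φ ψ : Formula} (h : φ ∈ S) (h' : ψ ∈ S)
      (D : Deriv S α Γ Δ c (pos (α φ))) (E : Deriv S α Γ Δ c (neg (α φ)))
      (F : Deriv S α Γ Δ c (pos (α ψ))) (K : SignedAtom) :
      DeleteRed (pr h' F (pr h D E (neg (α ψ))) K) (pr h D E K)
  | absurd_pr {c : List SignedAtom} {φ : Formula} {N : SignedAtom} (h : φ ∈ S) (h' : IsAbsurd N)
      (D : Deriv S α Γ Δ c (pos (α φ))) (E : Deriv S α Γ Δ c (neg (α φ))) (K : SignedAtom) :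
      DeleteRed (absurd h' (pr h D E N) K) (pr h D E K)
  | pr_absurd₁ {c : List SignedAtom} {ψ : Formula} {N : SignedAtom} (h : IsAbsurd N) (h' : ψ ∈ S)
      (D : Deriv S α Γ Δ c N) (F : Deriv S α Γ Δ c (neg (α ψ))) (K : SignedAtom) :
      DeleteRed (pr h' (absurd h D (pos (α ψ))) F K) (absurd h D K)
  | pr_absurd₂ {c : List SignedAtom} {ψ : Formula} {N : SignedAtom} (h : IsAbsurd N) (h' : ψ ∈ S)
      (D : Deriv S α Γ Δ c N) (F : Deriv S α Γ Δ c (pos (α ψ))) (K : SignedAtom) :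
      DeleteRed (pr h' F (absurd h D (neg (α ψ))) K) (absurd h D K)
  | absurd_absurd {c : List SignedAtom} {N N' : SignedAtom} (h : IsAbsurd N) (h' : IsAbsurd N')
      (D : Deriv S α Γ Δ c N) (K : SignedAtom) :
      DeleteRed (absurd h' (absurd h D N') K) (absurd h D K)

/-- One reduction step, applied to a subderivation. -/
inductive Step : ∀ {c : List SignedAtom} {J : SignedAtom},
    Deriv S α Γ Δ c J → Deriv S α Γ Δ c J → Prop
  | proper {c : List SignedAtom} {J : SignedAtom} {D D' : Deriv S α Γ Δ c J}
      (r : ProperRed D D') : Step D D'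
  | perm {c : List SignedAtom} {J : SignedAtom} {D D' : Deriv S α Γ Δ c J}
      (r : PermRed D D') : Step D D'
  | expand {c : List SignedAtom} {J : SignedAtom} {D D' : Deriv S α Γ Δ c J}
      (r : ExpandRed D D') : Step D D'
  | delete {c : List SignedAtom} {J : SignedAtom} {D D' : Deriv S α Γ Δ c J}
      (r : DeleteRed D D') : Step D D'
  | pairI_left {c : List SignedAtom} {C A B : SignedAtom} (h : IsPair S α C A B)
      {D D' : Deriv S α Γ Δ c A} (E : Deriv S α Γ Δ c B) (r : Step D D') :
      Step (pairI h D E) (pairI h D' E)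
  | pairI_right {c : List SignedAtom} {C A B : SignedAtom} (h : IsPair S α C A B)
      (D : Deriv S α Γ Δ c A) {E E' : Deriv S α Γ Δ c B} (r : Step E E') :
      Step (pairI h D E) (pairI h D E')
  | pairE₁ {c : List SignedAtom} {C A B : SignedAtom} (h : IsPair S α C A B)
      {D D' : Deriv S α Γ Δ c C} (r : Step D D') : Step (pairE₁ h D) (pairE₁ h D')
  | pairE₂ {c : List SignedAtom} {C A B : SignedAtom} (h : IsPair S α C A B)
      {D D' : Deriv S α Γ Δ c C} (r : Step D D') : Step (pairE₂ h D) (pairE₂ h D')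
  | condI {c : List SignedAtom} {C A B : SignedAtom} (h : IsCond S α C A B)
      {D D' : Deriv S α Γ Δ (A :: c) B} (r : Step D D') : Step (condI h D) (condI h D')
  | condE_major {c : List SignedAtom} {C A B : SignedAtom} (h : IsCond S α C A B)
      {D D' : Deriv S α Γ Δ c C} (E : Deriv S α Γ Δ c A) (r : Step D D') :
      Step (condE h D E) (condE h D' E)
  | condE_minor {c : List SignedAtom} {C A B : SignedAtom} (h : IsCond S α C A B)
      (D : Deriv S α Γ Δ c C) {E E' : Deriv S α Γ Δ c A} (r : Step E E') :
      Step (condE h D E) (condE h D E')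
  | caseI₁ {c : List SignedAtom} {C A B : SignedAtom} (h : IsCase S α C A B)
      {D D' : Deriv S α Γ Δ c A} (r : Step D D') : Step (caseI₁ h D) (caseI₁ h D')
  | caseI₂ {c : List SignedAtom} {C A B : SignedAtom} (h : IsCase S α C A B)
      {D D' : Deriv S α Γ Δ c B} (r : Step D D') : Step (caseI₂ h D) (caseI₂ h D')
  | caseE_major {c : List SignedAtom} {C A B K : SignedAtom} (h : IsCase S α C A B)
      {D D' : Deriv S α Γ Δ c C} (E : Deriv S α Γ Δ (A :: c) K) (F : Deriv S α Γ Δ (B :: c) K)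
      (r : Step D D') : Step (caseE h D E F) (caseE h D' E F)
  | caseE_left {c : List SignedAtom} {C A B K : SignedAtom} (h : IsCase S α C A B)
      (D : Deriv S α Γ Δ c C) {E E' : Deriv S α Γ Δ (A :: c) K} (F : Deriv S α Γ Δ (B :: c) K)
      (r : Step E E') : Step (caseE h D E F) (caseE h D E' F)
  | caseE_right {c : List SignedAtom} {C A B K : SignedAtom} (h : IsCase S α C A B)
      (D : Deriv S α Γ Δ c C) (E : Deriv S α Γ Δ (A :: c) K) {F F' : Deriv S α Γ Δ (B :: c) K}
      (r : Step F F') : Step (caseE h D E F) (caseE h D E F')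
  | absurd {c : List SignedAtom} {N : SignedAtom} (h : IsAbsurd N) {D D' : Deriv S α Γ Δ c N}
      (K : SignedAtom) (r : Step D D') : Step (absurd h D K) (absurd h D' K)
  | pr_left {c : List SignedAtom} {φ : Formula} (h : φ ∈ S) {D D' : Deriv S α Γ Δ c (pos (α φ))}
      (E : Deriv S α Γ Δ c (neg (α φ))) (K : SignedAtom) (r : Step D D') :
      Step (pr h D E K) (pr h D' E K)
  | pr_right {c : List SignedAtom} {φ : Formula} (h : φ ∈ S) (D : Deriv S α Γ Δ c (pos (α φ)))
      {E E' : Deriv S α Γ Δ c (neg (α φ))} (K : SignedAtom) (r : Step E E') :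
      Step (pr h D E K) (pr h D E' K)

/-- `D` reduces to `D'`: finitely many (possibly zero) reduction steps lead from `D` to `D'`. -/
def Reduces {c : List SignedAtom} {J : SignedAtom} (D D' : Deriv S α Γ Δ c J) : Prop :=
  Relation.ReflTransGen Step D D'

end Reduction

/-! ### Maximal segments and normal form -/

open Classical in
/-- The degree of a signed atom: the degree of `φ` for `p^φ` with `φ ∈ S` (unambiguous when `α` is
injective on `S`), and 0 for atoms that represent no formula in `S`. -/
noncomputable def SignedAtom.degree (S : Set Formula) (α : Formula → Atom) : SignedAtom → ℕ
  | pos a => if h : ∃ φ ∈ S, α φ = a then h.choose.degree else 0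
  | neg a => if h : ∃ φ ∈ S, α φ = a then h.choose.degree else 0

namespace Deriv

variable {S : Set Formula} {α : Formula → Atom} {Γ Δ : Set Atom}

/-- The lengths of all segments that end in the conclusion of the derivation and whose first
occurrence is the conclusion of an introduction rule; in such a segment every occurrence but the last
is a minor premise of `E∨(+)` or `E∧(-)`, and the next occurrence is the conclusion of that
application. -/
def introSegments {c : List SignedAtom} {J : SignedAtom} : Deriv S α Γ Δ c J → List ℕ
  | pairI _ _ _ => [1]
  | condI _ _ => [1]
  | caseI₁ _ _ => [1]
  | caseI₂ _ _ => [1]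
  | caseE _ _ E F => (E.introSegments ++ F.introSegments).map (· + 1)
  | _ => []

/-- The maximal segments of a derivation, each recorded as (degree, length): the segments that start
with the conclusion of an introduction rule and end with the major premise of an elimination rule. -/
noncomputable def maximalSegments {c : List SignedAtom} {J : SignedAtom} :
    Deriv S α Γ Δ c J → List (ℕ × ℕ)
  | premise _ => []
  | var _ => []
  | topPos => []
  | botNeg => []
  | pairI _ D E => D.maximalSegments ++ E.maximalSegments
  | pairE₁ (C := C) _ D =>
      D.introSegments.map (fun n => (C.degree S α, n)) ++ D.maximalSegments
  | pairE₂ (C := C) _ D =>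
      D.introSegments.map (fun n => (C.degree S α, n)) ++ D.maximalSegments
  | condI _ D => D.maximalSegments
  | condE (C := C) _ D E =>
      D.introSegments.map (fun n => (C.degree S α, n)) ++
        (D.maximalSegments ++ E.maximalSegments)
  | caseI₁ _ D => D.maximalSegments
  | caseI₂ _ D => D.maximalSegments
  | caseE (C := C) _ D E F =>
      D.introSegments.map (fun n => (C.degree S α, n)) ++
        (D.maximalSegments ++ (E.maximalSegments ++ F.maximalSegments))
  | absurd _ D _ => D.maximalSegments
  | pr _ D E _ => D.maximalSegments ++ E.maximalSegments

/-- The highest degree of a maximal segment (0 if there is none). -/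
noncomputable def maxDegree {c : List SignedAtom} {J : SignedAtom} (D : Deriv S α Γ Δ c J) : ℕ :=
  (D.maximalSegments.map Prod.fst).foldr max 0

/-- The inductive value: the highest degree `d` of a maximal segment, and the sum of the lengths of
all maximal segments of degree `d`. -/
noncomputable def inductiveValue {c : List SignedAtom} {J : SignedAtom}
    (D : Deriv S α Γ Δ c J) : ℕ × ℕ :=
  (D.maxDegree, ((D.maximalSegments.filter (fun s => s.1 = D.maxDegree)).map Prod.snd).sum)

/-- A derivation is in normal form if its inductive value is `(0, 0)`. -/
def IsNormal {c : List SignedAtom} {J : SignedAtom} (D : Deriv S α Γ Δ c J) : Prop :=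
  D.inductiveValue = (0, 0)

end Deriv

end BPR

namespace BPR

open SignedAtom Deriv

variable {S : Set Formula} {α : Formula → Atom} {Γ Δ : Set Atom}

/-! ### Shapes and degrees -/

/-! The proof is a reducibility argument, aiming at a derivation that has no maximal segments at
all. For each signed atom a class of values is defined by recursion on the degree (`Value`). A value
is one of three things: a neutral derivation, below which an elimination creates no maximal segment;
an introduction from values, where for a discharging introduction the body must evaluate whenever a
value is put above the discharged class; or a case elimination with neutral major premise whose
minor premises are again values. A derivation evaluates if it reduces to a value.

Two facts carry the argument. Every value reduces to a derivation without maximal segments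
(`Value.exists_reduces`). And an elimination whose major premise is a value evaluates
(`Value.evaluates_pairE`, `Value.evaluates_condE`, `Value.evaluates_caseE`): if the value is an
introduction, a proper reduction applies; if it is a case elimination, a permutative reduction moves
the elimination to smaller values; if it is neutral, no maximal segment arises there. Induction on
derivations then gives `evaluates_subst`, and the theorem is its instance for the identity
substitution.

Recursion on values thus replaces a descent on the inductive value. Only proper and permutative
steps are performed: a conclusion of PR or explosion never begins a maximal segment, so such a
derivation is neutral once its premises have no maximal segments. -/

theorem Formula.mem_subformulas_self (φ : Formula) : φ ∈ φ.subformulas := by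
  cases φ <;> simp [Formula.subformulas]

theorem Formula.subformulas_trans {φ ψ χ : Formula} (h : φ ∈ ψ.subformulas)
    (h' : ψ ∈ χ.subformulas) : φ ∈ χ.subformulas := by
  induction χ with
  | atom a =>
    simp only [subformulas, Set.mem_singleton_iff] at h'
    subst h'
    exact h
  | and χ₁ χ₂ ih₁ ih₂ | or χ₁ χ₂ ih₁ ih₂ | imp χ₁ χ₂ ih₁ ih₂ | coimp χ₁ χ₂ ih₁ ih₂ =>
    rw [subformulas] at h'
    rcases h' with rfl | h' | h'
    · exact h
    · exact Or.inr (Or.inl (ih₁ h'))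
    · exact Or.inr (Or.inr (ih₂ h'))

theorem mem_Sub_of_mem_subformulas {Θ : Set Formula} {φ ψ : Formula} (hψ : ψ ∈ Sub Θ)
    (h : φ ∈ ψ.subformulas) : φ ∈ Sub Θ := by
  obtain ⟨χ, hχ, hψχ⟩ := hψ
  exact ⟨χ, hχ, Formula.subformulas_trans h hψχ⟩

/-- Closure of a set of formulas under subformulas. -/
def SubformulaClosed (S : Set Formula) : Prop :=
  ∀ ψ ∈ S, ∀ φ ∈ ψ.subformulas, φ ∈ S

theorem subformulaClosed_Sub (Θ : Set Formula) : SubformulaClosed (Sub Θ) :=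
  fun _ hψ _ h => mem_Sub_of_mem_subformulas hψ h

/-- Injectivity forces the formula chosen in `SignedAtom.degree` to be `φ` itself. -/
theorem degree_pos (hα : Set.InjOn α S) {φ : Formula} (h : φ ∈ S) :
    (pos (α φ)).degree S α = φ.degree := by
  have hex : ∃ ψ ∈ S, α ψ = α φ := ⟨φ, h, rfl⟩
  rw [SignedAtom.degree, dif_pos hex, hα hex.choose_spec.1 h hex.choose_spec.2]

theorem degree_neg (hα : Set.InjOn α S) {φ : Formula} (h : φ ∈ S) :
    (neg (α φ)).degree S α = φ.degree := by
  have hex : ∃ ψ ∈ S, α ψ = α φ := ⟨φ, h, rfl⟩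
  rw [SignedAtom.degree, dif_pos hex, hα hex.choose_spec.1 h hex.choose_spec.2]

/-- Closure under subformulas is essential: were a component outside `S`, its atom could stand for
another formula of `S`, of any degree. The strict drop is what permits the recursion defining
`Value`. -/
theorem IsPair.degree_lt (hα : Set.InjOn α S) (hS : SubformulaClosed S) {C A B : SignedAtom}
    (h : IsPair S α C A B) :
    A.degree S α < C.degree S α ∧ B.degree S α < C.degree S α := by
  cases h with
  | and_pos φ ψ h | or_neg φ ψ h | coimp_pos φ ψ h | imp_neg φ ψ h =>
    have hφ : φ ∈ S := hS _ h _ (by simp [Formula.subformulas, φ.mem_subformulas_self])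
    have hψ : ψ ∈ S := hS _ h _ (by simp [Formula.subformulas, ψ.mem_subformulas_self])
    simp only [degree_pos hα, degree_neg hα, h, hφ, hψ, Formula.degree]
    omega

theorem IsCase.degree_lt (hα : Set.InjOn α S) (hS : SubformulaClosed S) {C A B : SignedAtom}
    (h : IsCase S α C A B) :
    A.degree S α < C.degree S α ∧ B.degree S α < C.degree S α := by
  cases h with
  | or_pos φ ψ h | and_neg φ ψ h =>
    have hφ : φ ∈ S := hS _ h _ (by simp [Formula.subformulas, φ.mem_subformulas_self])
    have hψ : ψ ∈ S := hS _ h _ (by simp [Formula.subformulas, ψ.mem_subformulas_self])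
    simp only [degree_pos hα, degree_neg hα, h, hφ, hψ, Formula.degree]
    omega

theorem IsCond.degree_lt (hα : Set.InjOn α S) (hS : SubformulaClosed S) {C A B : SignedAtom}
    (h : IsCond S α C A B) :
    A.degree S α < C.degree S α ∧ B.degree S α < C.degree S α := by
  cases h with
  | imp_pos φ ψ h | coimp_neg φ ψ h =>
    have hφ : φ ∈ S := hS _ h _ (by simp [Formula.subformulas, φ.mem_subformulas_self])
    have hψ : ψ ∈ S := hS _ h _ (by simp [Formula.subformulas, ψ.mem_subformulas_self])
    simp only [degree_pos hα, degree_neg hα, h, hφ, hψ, Formula.degree]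
    omega

/-- The kinds of rules attached to a compound signed atom. -/
inductive RuleKind
  | pair
  | case
  | cond

/-- `C` has rules of the given kind, with immediate components `A` and `B`. -/
def HasRules (S : Set Formula) (α : Formula → Atom) (C A B : SignedAtom) : RuleKind → Prop
  | .pair => IsPair S α C A B
  | .case => IsCase S α C A B
  | .cond => IsCond S α C A B

/-- The kind of rules and the components of the positive and the negative atom of a formula. -/
def Formula.components (α : Formula → Atom) :
    Bool → Formula → Option (RuleKind × SignedAtom × SignedAtom)
  | _, atom _ => none
  | true, and φ ψ => some (.pair, pos (α φ), pos (α ψ))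
  | false, and φ ψ => some (.case, neg (α φ), neg (α ψ))
  | true, or φ ψ => some (.case, pos (α φ), pos (α ψ))
  | false, or φ ψ => some (.pair, neg (α φ), neg (α ψ))
  | true, imp φ ψ => some (.cond, pos (α φ), pos (α ψ))
  | false, imp φ ψ => some (.pair, pos (α φ), neg (α ψ))
  | true, coimp φ ψ => some (.pair, pos (α φ), neg (α ψ))
  | false, coimp φ ψ => some (.cond, neg (α ψ), neg (α φ))

/-- Passing from the rule tables to a sign and a formula turns uniqueness of rules into the
single-valuedness of the function `Formula.components`. -/
theorem HasRules.exists_formula {C A B : SignedAtom} {k : RuleKind} (h : HasRules S α C A B k) :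
    ∃ (b : Bool) (φ : Formula), φ ∈ S ∧ C = (if b then pos (α φ) else neg (α φ)) ∧
      φ.components α b = some (k, A, B) := by
  cases k <;> cases h
  case pair.and_pos φ ψ h => exact ⟨true, _, h, rfl, rfl⟩
  case pair.or_neg φ ψ h => exact ⟨false, _, h, rfl, rfl⟩
  case pair.coimp_pos φ ψ h => exact ⟨true, _, h, rfl, rfl⟩
  case pair.imp_neg φ ψ h => exact ⟨false, _, h, rfl, rfl⟩
  case case.or_pos φ ψ h => exact ⟨true, _, h, rfl, rfl⟩
  case case.and_neg φ ψ h => exact ⟨false, _, h, rfl, rfl⟩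
  case cond.imp_pos φ ψ h => exact ⟨true, _, h, rfl, rfl⟩
  case cond.coimp_neg φ ψ h => exact ⟨false, _, h, rfl, rfl⟩

/-- A signed atom fixes its sign and, by injectivity, its formula. Hence an introduction and an
elimination meeting at one signed atom always match, and a proper reduction is available. -/
theorem HasRules.unique (hα : Set.InjOn α S) {C A B A' B' : SignedAtom} {k k' : RuleKind}
    (h : HasRules S α C A B k) (h' : HasRules S α C A' B' k') : k = k' ∧ A = A' ∧ B = B' := by
  obtain ⟨b, φ, hφ, hC, e⟩ := h.exists_formula
  obtain ⟨b', φ', hφ', hC', e'⟩ := h'.exists_formula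
  have hb : b = b' ∧ α φ = α φ' := by
    subst hC
    cases b <;> cases b' <;> simp_all
  obtain ⟨rfl, hαφ⟩ := hb
  obtain rfl := hα hφ hφ' hαφ
  simpa using e.symm.trans e'

/-! ### Renaming and substitution -/

theorem Ren.lift_comp {c c' c'' : List SignedAtom} (ρ : Ren c c') (ρ' : Ren c' c'')
    (K : SignedAtom) :
    (fun J x => ρ'.lift K J (ρ.lift K J x)) = Ren.lift (fun J x => ρ' J (ρ J x)) K := by
  funext J x
  cases x <;> rfl

namespace Deriv

theorem rename_rename {c c' c'' : List SignedAtom} {J : SignedAtom} (D : Deriv S α Γ Δ c J)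
    (ρ : Ren c c') (ρ' : Ren c' c'') :
    (D.rename ρ).rename ρ' = D.rename (fun J x => ρ' J (ρ J x)) := by
  induction D generalizing c' c'' <;> simp_all [rename, Ren.lift_comp]

theorem subst_rename_left {c c' c'' : List SignedAtom} {J : SignedAtom} (D : Deriv S α Γ Δ c J)
    (ρ : Ren c c') (σ : Subst S α Γ Δ c' c'') :
    (D.rename ρ).subst σ = D.subst (fun J x => σ J (ρ J x)) := by
  have hl : ∀ {c c' c'' : List SignedAtom} (ρ : Ren c c') (σ : Subst S α Γ Δ c' c'')
      (K : SignedAtom), (fun J x => σ.lift K J (ρ.lift K J x)) =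
        Subst.lift (fun J x => σ J (ρ J x)) K := by
    intro c c' c'' ρ σ K
    funext J x
    cases x <;> rfl
  induction D generalizing c' c'' <;> simp_all [rename, subst]

theorem rename_subst {c c' c'' : List SignedAtom} {J : SignedAtom} (D : Deriv S α Γ Δ c J)
    (σ : Subst S α Γ Δ c c') (ρ : Ren c' c'') :
    (D.subst σ).rename ρ = D.subst (fun J x => (σ J x).rename ρ) := by
  have hl : ∀ {c c' c'' : List SignedAtom} (σ : Subst S α Γ Δ c c') (ρ : Ren c' c'')
      (K : SignedAtom), (fun J x => (σ.lift K J x).rename (ρ.lift K)) =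
        Subst.lift (fun J x => (σ J x).rename ρ) K := by
    intro c c' c'' σ ρ K
    funext J x
    cases x with
    | zero => rfl
    | succ x => exact (rename_rename _ _ _).trans (rename_rename (σ J x) ρ (fun _ x => Var.succ x)).symm
  induction D generalizing c' c'' <;> simp_all [rename, subst]

/-- Under a binder the images of old classes are weakened, that is, renamed; commuting substitution
with this weakening requires the two mixed laws `subst_rename_left` and `rename_subst`. -/
theorem subst_subst {c c' c'' : List SignedAtom} {J : SignedAtom} (D : Deriv S α Γ Δ c J)
    (σ : Subst S α Γ Δ c c') (τ : Subst S α Γ Δ c' c'') :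
    (D.subst σ).subst τ = D.subst (fun J x => (σ J x).subst τ) := by
  have hl : ∀ {c c' c'' : List SignedAtom} (σ : Subst S α Γ Δ c c') (τ : Subst S α Γ Δ c' c'')
      (K : SignedAtom), (fun J x => (σ.lift K J x).subst (τ.lift K)) =
        Subst.lift (fun J x => (σ J x).subst τ) K := by
    intro c c' c'' σ τ K
    funext J x
    cases x with
    | zero => rfl
    | succ x => exact (subst_rename_left _ _ _).trans (rename_subst (σ J x) τ (fun _ x => Var.succ x)).symm
  induction D generalizing c' c'' <;> simp_all [subst]

theorem subst_var {c : List SignedAtom} {J : SignedAtom} (D : Deriv S α Γ Δ c J) :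
    D.subst (fun _ x => var x) = D := by
  have hl : ∀ (c : List SignedAtom) (K : SignedAtom),
      Subst.lift (S := S) (α := α) (Γ := Γ) (Δ := Δ) (c := c) (fun _ x => var x) K =
        fun _ x => var x := by
    intro c K
    funext J x
    cases x <;> rfl
  induction D <;> simp_all [subst]

theorem rename_id {c : List SignedAtom} {J : SignedAtom} (D : Deriv S α Γ Δ c J) :
    D.rename (fun _ x => x) = D := by
  have hl : ∀ (c : List SignedAtom) (K : SignedAtom),
      Ren.lift (c := c) (fun _ x => x) K = fun _ x => x := by
    intro c K
    funext J x
    cases x <;> rfl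
  induction D <;> simp_all [rename]

end Deriv

/-! ### Plugging, and invariance of segments under renaming -/

/-- Extension of a substitution by a derivation for a new class. -/
def Subst.cons {c c' : List SignedAtom} {A : SignedAtom} (V : Deriv S α Γ Δ c' A)
    (σ : Subst S α Γ Δ c c') : Subst S α Γ Δ (A :: c) c'
  | _, Var.zero => V
  | _, Var.succ x => σ _ x

namespace Deriv

/-- Turns the body of a discharging rule, after substitution, renaming and plugging, into one
instance of simultaneous substitution, so that the induction hypothesis of `evaluates_subst`
applies. -/
theorem plug_rename_lift_subst_lift {c c' c'' : List SignedAtom} {A J : SignedAtom}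
    (D : Deriv S α Γ Δ (A :: c) J) (σ : Subst S α Γ Δ c c') (ρ : Ren c' c'')
    (V : Deriv S α Γ Δ c'' A) :
    ((D.subst (σ.lift A)).rename (ρ.lift A)).plug V =
      D.subst (Subst.cons V (fun J x => (σ J x).rename ρ)) := by
  refine (congrArg (subst _) (rename_subst D _ _)).trans ((subst_subst D _ _).trans ?_)
  congr 1
  funext J x
  cases x with
  | zero => rfl
  | succ x =>
    refine (congrArg (subst _) (rename_rename (σ J x) _ _)).trans
      ((subst_rename_left _ _ _).trans ?_)
    refine Eq.trans ?_ (subst_var ((σ J x).rename ρ))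
    exact (subst_rename_left (σ J x) ρ _).symm

theorem plug_weaken_lift {c : List SignedAtom} {A J : SignedAtom} (D : Deriv S α Γ Δ (A :: c) J) :
    (D.rename (Ren.lift (fun _ x => Var.succ x) A)).plug (var (Var.zero (c := c))) = D := by
  rw [plug, subst_rename_left]
  conv_rhs => rw [← subst_var D]
  congr 1
  funext J x
  cases x <;> rfl

@[simp]
theorem introSegments_rename {c c' : List SignedAtom} {J : SignedAtom} (D : Deriv S α Γ Δ c J)
    (ρ : Ren c c') : (D.rename ρ).introSegments = D.introSegments := by
  induction D generalizing c' <;> simp_all [rename, introSegments]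

@[simp]
theorem maximalSegments_rename {c c' : List SignedAtom} {J : SignedAtom}
    (D : Deriv S α Γ Δ c J) (ρ : Ren c c') :
    (D.rename ρ).maximalSegments = D.maximalSegments := by
  induction D generalizing c' <;> simp_all [rename, maximalSegments]

theorem isNormal_of_maximalSegments_eq_nil {c : List SignedAtom} {J : SignedAtom}
    {D : Deriv S α Γ Δ c J} (h : D.maximalSegments = []) : D.IsNormal := by
  simp [IsNormal, inductiveValue, maxDegree, h]

end Deriv

/-! ### Reductions inside derivations -/

namespace Reduces

variable {c : List SignedAtom} {C A B K : SignedAtom}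

theorem pairI (h : IsPair S α C A B) {D D' : Deriv S α Γ Δ c A} {E E' : Deriv S α Γ Δ c B}
    (r : Reduces D D') (s : Reduces E E') : Reduces (pairI h D E) (pairI h D' E') :=
  (Relation.ReflTransGen.lift (fun X => Deriv.pairI h X E) (fun _ _ => Step.pairI_left h E) _ _ r).trans
    (Relation.ReflTransGen.lift (fun X => Deriv.pairI h D' X) (fun _ _ => Step.pairI_right h D') _ _ s)

theorem pairE₁ (h : IsPair S α C A B) {D D' : Deriv S α Γ Δ c C} (r : Reduces D D') :
    Reduces (pairE₁ h D) (pairE₁ h D') :=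
  Relation.ReflTransGen.lift (Deriv.pairE₁ h) (fun _ _ => Step.pairE₁ h) _ _ r

theorem pairE₂ (h : IsPair S α C A B) {D D' : Deriv S α Γ Δ c C} (r : Reduces D D') :
    Reduces (pairE₂ h D) (pairE₂ h D') :=
  Relation.ReflTransGen.lift (Deriv.pairE₂ h) (fun _ _ => Step.pairE₂ h) _ _ r

theorem condI (h : IsCond S α C A B) {D D' : Deriv S α Γ Δ (A :: c) B} (r : Reduces D D') :
    Reduces (condI h D) (condI h D') :=
  Relation.ReflTransGen.lift (Deriv.condI h) (fun _ _ => Step.condI h) _ _ r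

theorem condE (h : IsCond S α C A B) {D D' : Deriv S α Γ Δ c C} {E E' : Deriv S α Γ Δ c A}
    (r : Reduces D D') (s : Reduces E E') : Reduces (condE h D E) (condE h D' E') :=
  (Relation.ReflTransGen.lift (fun X => Deriv.condE h X E) (fun _ _ => Step.condE_major h E) _ _ r).trans
    (Relation.ReflTransGen.lift (fun X => Deriv.condE h D' X) (fun _ _ => Step.condE_minor h D') _ _ s)

theorem caseI₁ (h : IsCase S α C A B) {D D' : Deriv S α Γ Δ c A} (r : Reduces D D') :
    Reduces (caseI₁ h D) (caseI₁ h D') :=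
  Relation.ReflTransGen.lift (Deriv.caseI₁ h) (fun _ _ => Step.caseI₁ h) _ _ r

theorem caseI₂ (h : IsCase S α C A B) {D D' : Deriv S α Γ Δ c B} (r : Reduces D D') :
    Reduces (caseI₂ h D) (caseI₂ h D') :=
  Relation.ReflTransGen.lift (Deriv.caseI₂ h) (fun _ _ => Step.caseI₂ h) _ _ r

theorem caseE (h : IsCase S α C A B) {D D' : Deriv S α Γ Δ c C}
    {E E' : Deriv S α Γ Δ (A :: c) K} {F F' : Deriv S α Γ Δ (B :: c) K}
    (r : Reduces D D') (s : Reduces E E') (t : Reduces F F') :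
    Reduces (caseE h D E F) (caseE h D' E' F') :=
  ((Relation.ReflTransGen.lift (fun X => Deriv.caseE h X E F)
      (fun _ _ => Step.caseE_major h E F) _ _ r).trans
    (Relation.ReflTransGen.lift (fun X => Deriv.caseE h D' X F)
      (fun _ _ => Step.caseE_left h D' F) _ _ s)).trans
    (Relation.ReflTransGen.lift (fun X => Deriv.caseE h D' E' X)
      (fun _ _ => Step.caseE_right h D' E') _ _ t)

theorem absurd (h : IsAbsurd A) {D D' : Deriv S α Γ Δ c A} (r : Reduces D D') :
    Reduces (absurd h D K) (absurd h D' K) :=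
  Relation.ReflTransGen.lift (fun X => Deriv.absurd h X K) (fun _ _ => Step.absurd h K) _ _ r

theorem pr {φ : Formula} (h : φ ∈ S) {D D' : Deriv S α Γ Δ c (pos (α φ))}
    {E E' : Deriv S α Γ Δ c (neg (α φ))} (r : Reduces D D') (s : Reduces E E') :
    Reduces (pr h D E K) (pr h D' E' K) :=
  (Relation.ReflTransGen.lift (fun X => Deriv.pr h X E K) (fun _ _ => Step.pr_left h E K) _ _ r).trans
    (Relation.ReflTransGen.lift (fun X => Deriv.pr h D' X K)
      (fun _ _ => Step.pr_right h D' K) _ _ s)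

theorem of_proper {D D' : Deriv S α Γ Δ c K} (r : ProperRed D D') : Reduces D D' :=
  .single (.proper r)

theorem of_perm {D D' : Deriv S α Γ Δ c K} (r : PermRed D D') : Reduces D D' :=
  .single (.perm r)

end Reduces

/-! ### Values -/

/-- Derivations without maximal segments in which moreover no segment that ends in the conclusion
starts with an introduction, so that an elimination may be added below. -/
def IsNeutral {c : List SignedAtom} {J : SignedAtom} (D : Deriv S α Γ Δ c J) : Prop :=
  D.introSegments = [] ∧ D.maximalSegments = []

/-- The values of `J`, relative to predicates `R` for the signed atoms of lower degree. -/
inductive ValueOver {J : SignedAtom}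
    (R : ∀ A : SignedAtom, A.degree S α < J.degree S α →
      ∀ c : List SignedAtom, Deriv S α Γ Δ c A → Prop) :
    ∀ c : List SignedAtom, Deriv S α Γ Δ c J → Prop
  | neutral {c : List SignedAtom} {D : Deriv S α Γ Δ c J} (h : IsNeutral D) : ValueOver R c D
  | pairI {c : List SignedAtom} {A B : SignedAtom} (h : IsPair S α J A B)
      {D : Deriv S α Γ Δ c A} {E : Deriv S α Γ Δ c B}
      (hA : A.degree S α < J.degree S α) (hB : B.degree S α < J.degree S α)
      (hD : R A hA c D) (hE : R B hB c E) : ValueOver R c (Deriv.pairI h D E)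
  | caseI₁ {c : List SignedAtom} {A B : SignedAtom} (h : IsCase S α J A B)
      {D : Deriv S α Γ Δ c A} (hA : A.degree S α < J.degree S α) (hD : R A hA c D) :
      ValueOver R c (Deriv.caseI₁ h D)
  | caseI₂ {c : List SignedAtom} {A B : SignedAtom} (h : IsCase S α J A B)
      {D : Deriv S α Γ Δ c B} (hB : B.degree S α < J.degree S α) (hD : R B hB c D) :
      ValueOver R c (Deriv.caseI₂ h D)
  | condI {c : List SignedAtom} {A B : SignedAtom} (h : IsCond S α J A B)
      {D : Deriv S α Γ Δ (A :: c) B}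
      (hA : A.degree S α < J.degree S α) (hB : B.degree S α < J.degree S α)
      -- All renamings are allowed so that values are stable under weakening. The predicate `R`
      -- occurs negatively here, hence it is a parameter, instantiated by recursion on degree,
      -- rather than part of the inductive definition.
      (hD : ∀ (c' : List SignedAtom) (ρ : Ren c c') (V : Deriv S α Γ Δ c' A), R A hA c' V →
        ∃ W, Reduces ((D.rename (ρ.lift A)).plug V) W ∧ R B hB c' W) :
      ValueOver R c (Deriv.condI h D)
  -- The minor premises are values of the same `J`, not of a lower degree, so this clause is
  -- inductive. It follows segments upwards through case eliminations.
  | caseE {c : List SignedAtom} {C A B : SignedAtom} (h : IsCase S α C A B)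
      {D : Deriv S α Γ Δ c C} {E : Deriv S α Γ Δ (A :: c) J} {F : Deriv S α Γ Δ (B :: c) J}
      (hD : IsNeutral D) (hE : ValueOver R (A :: c) E) (hF : ValueOver R (B :: c) F) :
      ValueOver R c (Deriv.caseE h D E F)

/-- The values of a signed atom, by recursion on its degree. -/
def Value (J : SignedAtom) : ∀ c : List SignedAtom, Deriv S α Γ Δ c J → Prop :=
  ValueOver fun A _ => Value A
termination_by J.degree S α

/-- `D` reduces to a value. -/
def Evaluates {c : List SignedAtom} {J : SignedAtom} (D : Deriv S α Γ Δ c J) : Prop :=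
  ∃ V, Reduces D V ∧ Value J c V

/-- `D` evaluates whenever a value is put above its last assumption class. -/
def BodyEvaluates {c : List SignedAtom} {A K : SignedAtom} (D : Deriv S α Γ Δ (A :: c) K) : Prop :=
  ∀ (c' : List SignedAtom) (ρ : Ren c c') (V : Deriv S α Γ Δ c' A), Value A c' V →
    Evaluates ((D.rename (ρ.lift A)).plug V)

/-! ### Stability of values under renaming, and their normal forms -/

theorem value_iff {c : List SignedAtom} {J : SignedAtom} {D : Deriv S α Γ Δ c J} :
    Value J c D ↔ ValueOver (fun A _ => Value A) c D := by
  rw [Value]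

theorem IsNeutral.rename {c c' : List SignedAtom} {J : SignedAtom} {D : Deriv S α Γ Δ c J}
    (h : IsNeutral D) (ρ : Ren c c') : IsNeutral (D.rename ρ) := by
  simpa [IsNeutral] using h

theorem IsNeutral.value {c : List SignedAtom} {J : SignedAtom} {D : Deriv S α Γ Δ c J}
    (h : IsNeutral D) : Value J c D :=
  value_iff.2 (.neutral h)

theorem Value.evaluates {c : List SignedAtom} {J : SignedAtom} {D : Deriv S α Γ Δ c J}
    (h : Value J c D) : Evaluates D :=
  ⟨D, .refl, h⟩

theorem isNeutral_var {c : List SignedAtom} {J : SignedAtom} (x : Var c J) :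
    IsNeutral (var x : Deriv S α Γ Δ c J) :=
  ⟨rfl, rfl⟩

theorem Evaluates.of_reduces {c : List SignedAtom} {J : SignedAtom} {D D' : Deriv S α Γ Δ c J}
    (r : Reduces D D') (h : Evaluates D') : Evaluates D := by
  obtain ⟨V, hV, hv⟩ := h
  exact ⟨V, r.trans hV, hv⟩

/-- Needed because permutative reductions and substitution under binders put values into larger
contexts. In the discharging case two renamings compose, and the clause already quantifies over all
of them. -/
theorem ValueOver.rename {J : SignedAtom}
    {R : ∀ A : SignedAtom, A.degree S α < J.degree S α →
      ∀ c : List SignedAtom, Deriv S α Γ Δ c A → Prop}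
    (hR : ∀ A hA c c' (D : Deriv S α Γ Δ c A) (ρ : Ren c c'), R A hA c D → R A hA c' (D.rename ρ))
    {c : List SignedAtom} {D : Deriv S α Γ Δ c J} (h : ValueOver R c D) {c' : List SignedAtom}
    (ρ : Ren c c') : ValueOver R c' (D.rename ρ) := by
  induction h generalizing c' with
  | neutral h => exact .neutral (h.rename ρ)
  | pairI h hA hB hD hE => exact .pairI h hA hB (hR _ _ _ _ _ ρ hD) (hR _ _ _ _ _ ρ hE)
  | caseI₁ h hA hD => exact .caseI₁ h hA (hR _ _ _ _ _ ρ hD)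
  | caseI₂ h hB hD => exact .caseI₂ h hB (hR _ _ _ _ _ ρ hD)
  | condI h hA hB hD =>
    refine .condI h hA hB fun c'' ρ' V hV => ?_
    rw [rename_rename, Ren.lift_comp]
    exact hD c'' _ V hV
  | caseE h hD _ _ ihE ihF => exact .caseE h (hD.rename ρ) (ihE _) (ihF _)

theorem Value.rename {J : SignedAtom} {c c' : List SignedAtom} {D : Deriv S α Γ Δ c J}
    (h : Value J c D) (ρ : Ren c c') : Value J c' (D.rename ρ) := by
  induction hn : J.degree S α using Nat.strong_induction_on generalizing J c c' with
  | _ n ih =>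
    subst hn
    exact value_iff.2 ((value_iff.1 h).rename (fun A hA c c' D ρ hD => ih _ hA hD ρ rfl) ρ)

theorem BodyEvaluates.rename {c c' : List SignedAtom} {A K : SignedAtom}
    {D : Deriv S α Γ Δ (A :: c) K} (h : BodyEvaluates D) (ρ : Ren c c') :
    BodyEvaluates (D.rename (ρ.lift A)) := by
  intro c'' ρ' V hV
  rw [rename_rename, Ren.lift_comp]
  exact h c'' _ V hV

/-- The discharged class itself, as a variable in the extended context, is a neutral value; plugging
it in gives back the body. -/
theorem BodyEvaluates.evaluates {c : List SignedAtom} {A K : SignedAtom}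
    {D : Deriv S α Γ Δ (A :: c) K} (h : BodyEvaluates D) : Evaluates D := by
  simpa only [plug_weaken_lift] using
    h (A :: c) (fun _ x => Var.succ x) _ (isNeutral_var Var.zero).value

theorem BodyEvaluates.plug {c : List SignedAtom} {A K : SignedAtom}
    {D : Deriv S α Γ Δ (A :: c) K} (h : BodyEvaluates D) {V : Deriv S α Γ Δ c A}
    (hV : Value A c V) : Evaluates (D.plug V) := by
  have hl : Ren.lift (c := c) (fun _ x => x) A = fun _ x => x := by
    funext J x
    cases x <;> rfl
  simpa only [hl, rename_id] using h c (fun _ x => x) V hV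

/-- Every value reduces to a derivation without maximal segments. -/
theorem Value.exists_reduces {J : SignedAtom} {c : List SignedAtom} {D : Deriv S α Γ Δ c J}
    (h : Value J c D) : ∃ D', Reduces D D' ∧ D'.maximalSegments = [] := by
  induction hn : J.degree S α using Nat.strong_induction_on generalizing J c with
  | _ n ih =>
    subst hn
    replace h := value_iff.1 h
    -- The outer induction on degree handles the components of introductions; this inner one handles
    -- nested case eliminations at a fixed signed atom.
    induction h with
    | neutral h => exact ⟨_, .refl, h.2⟩
    | pairI h hA hB hD hE =>
      obtain ⟨D', rD, nD⟩ := ih _ hA hD rfl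
      obtain ⟨E', rE, nE⟩ := ih _ hB hE rfl
      exact ⟨_, rD.pairI h rE, by simp [maximalSegments, nD, nE]⟩
    | caseI₁ h hA hD =>
      obtain ⟨D', rD, nD⟩ := ih _ hA hD rfl
      exact ⟨_, rD.caseI₁ h, by simp [maximalSegments, nD]⟩
    | caseI₂ h hB hD =>
      obtain ⟨D', rD, nD⟩ := ih _ hB hD rfl
      exact ⟨_, rD.caseI₂ h, by simp [maximalSegments, nD]⟩
    | condI h hA hB hD =>
      -- With `R` taken to be `Value`, the clause `hD` is literally `BodyEvaluates`.
      obtain ⟨W, rW, hW⟩ := BodyEvaluates.evaluates hD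
      obtain ⟨D', rD, nD⟩ := ih _ hB hW rfl
      exact ⟨_, Reduces.condI h (rW.trans rD), by simp [maximalSegments, nD]⟩
    | caseE h hD _ _ ihE ihF =>
      obtain ⟨E', rE, nE⟩ := ihE
      obtain ⟨F', rF, nF⟩ := ihF
      exact ⟨_, Reduces.caseE h .refl rE rF, by simp [maximalSegments, hD.1, hD.2, nE, nF]⟩

theorem Evaluates.exists_reduces {J : SignedAtom} {c : List SignedAtom} {D : Deriv S α Γ Δ c J}
    (h : Evaluates D) : ∃ D', Reduces D D' ∧ D'.maximalSegments = [] := by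
  obtain ⟨V, rV, hV⟩ := h
  obtain ⟨D', rD, nD⟩ := hV.exists_reduces
  exact ⟨D', rV.trans rD, nD⟩

/-! ### Evaluation of rule applications -/

section Evaluation

variable {c : List SignedAtom} {C A B K : SignedAtom}

/-- No segment beginning with an introduction can end in the conclusion of an explosion rule, so the
result is neutral for every `K`, compound or not. -/
theorem evaluates_absurd (h : IsAbsurd A) {D : Deriv S α Γ Δ c A} (hD : Evaluates D) :
    Evaluates (absurd h D K) := by
  obtain ⟨D', rD, nD⟩ := hD.exists_reduces
  exact ⟨_, rD.absurd h, IsNeutral.value ⟨rfl, nD⟩⟩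

theorem evaluates_pr {φ : Formula} (h : φ ∈ S) {D : Deriv S α Γ Δ c (pos (α φ))}
    {E : Deriv S α Γ Δ c (neg (α φ))} (hD : Evaluates D) (hE : Evaluates E) :
    Evaluates (pr h D E K) := by
  obtain ⟨D', rD, nD⟩ := hD.exists_reduces
  obtain ⟨E', rE, nE⟩ := hE.exists_reduces
  exact ⟨_, rD.pr h rE, IsNeutral.value ⟨rfl, by simp [maximalSegments, nD, nE]⟩⟩

theorem evaluates_caseE_of_isNeutral (h : IsCase S α C A B) {D : Deriv S α Γ Δ c C}
    {E : Deriv S α Γ Δ (A :: c) K} {F : Deriv S α Γ Δ (B :: c) K}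
    (hD : IsNeutral D) (hE : Evaluates E) (hF : Evaluates F) : Evaluates (caseE h D E F) := by
  obtain ⟨E', rE, vE⟩ := hE
  obtain ⟨F', rF, vF⟩ := hF
  exact ⟨_, Reduces.caseE h .refl rE rF,
    value_iff.2 (.caseE h hD (value_iff.1 vE) (value_iff.1 vF))⟩

/-- By induction on the value of the major premise; introductions of another kind are excluded by
`HasRules.unique`. -/
theorem Value.evaluates_pairE (hα : Set.InjOn α S) (h : IsPair S α C A B)
    {D : Deriv S α Γ Δ c C} (hD : Value C c D) :
    Evaluates (pairE₁ h D) ∧ Evaluates (pairE₂ h D) := by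
  replace hD := value_iff.1 hD
  have hr : HasRules S α C A B .pair := h
  induction hD with
  | neutral hD =>
    exact ⟨(IsNeutral.value ⟨rfl, by simp [maximalSegments, hD.1, hD.2]⟩).evaluates,
      (IsNeutral.value ⟨rfl, by simp [maximalSegments, hD.1, hD.2]⟩).evaluates⟩
  | pairI h' hA hB hD hE =>
    obtain ⟨-, rfl, rfl⟩ := hr.unique hα (k' := .pair) h'
    exact ⟨⟨_, .of_proper (.pair₁ h _ _), hD⟩, ⟨_, .of_proper (.pair₂ h _ _), hE⟩⟩
  | caseI₁ h' | caseI₂ h' => cases (hr.unique hα (k' := .case) h').1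
  | condI h' => cases (hr.unique hα (k' := .cond) h').1
  | caseE h' hD _ _ ihE ihF =>
    exact ⟨.of_reduces (.of_perm (.pair₁ h' h _ _ _))
        (evaluates_caseE_of_isNeutral h' hD ihE.1 ihF.1),
      .of_reduces (.of_perm (.pair₂ h' h _ _ _))
        (evaluates_caseE_of_isNeutral h' hD ihE.2 ihF.2)⟩

theorem Value.evaluates_condE (hα : Set.InjOn α S) (h : IsCond S α C A B)
    {D : Deriv S α Γ Δ c C} {E : Deriv S α Γ Δ c A} (hD : Value C c D) (hE : Value A c E) :
    Evaluates (condE h D E) := by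
  replace hD := value_iff.1 hD
  have hr : HasRules S α C A B .cond := h
  induction hD with
  | neutral hD =>
    -- A value may still contain maximal segments, so the minor premise must be normalised before
    -- the whole is neutral.
    obtain ⟨E', rE, nE⟩ := hE.exists_reduces
    exact ⟨_, Reduces.condE h .refl rE,
      IsNeutral.value ⟨rfl, by simp [maximalSegments, hD.1, hD.2, nE]⟩⟩
  | condI h' hA hB hD =>
    obtain ⟨-, rfl, rfl⟩ := hr.unique hα (k' := .cond) h'
    exact .of_reduces (.of_proper (.cond h _ _)) (BodyEvaluates.plug hD hE)
  | caseI₁ h' | caseI₂ h' => cases (hr.unique hα (k' := .case) h').1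
  | pairI h' => cases (hr.unique hα (k' := .pair) h').1
  | caseE h' hD _ _ ihE ihF =>
    exact .of_reduces (.of_perm (.cond h' h _ _ _ _))
      (evaluates_caseE_of_isNeutral h' hD (ihE (hE.rename _)) (ihF (hE.rename _)))

theorem Value.evaluates_caseE (hα : Set.InjOn α S) (h : IsCase S α C A B)
    {D : Deriv S α Γ Δ c C} {E : Deriv S α Γ Δ (A :: c) K} {F : Deriv S α Γ Δ (B :: c) K}
    (hD : Value C c D) (hE : BodyEvaluates E) (hF : BodyEvaluates F) :
    Evaluates (caseE h D E F) := by
  replace hD := value_iff.1 hD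
  have hr : HasRules S α C A B .case := h
  induction hD with
  -- No introduction is available to plug in, so the cases are evaluated with their discharged
  -- classes left open.
  | neutral hD => exact evaluates_caseE_of_isNeutral h hD hE.evaluates hF.evaluates
  | caseI₁ h' _ hD =>
    obtain ⟨-, rfl, rfl⟩ := hr.unique hα (k' := .case) h'
    exact .of_reduces (.of_proper (.case₁ h _ _ _)) (hE.plug hD)
  | caseI₂ h' _ hD =>
    obtain ⟨-, rfl, rfl⟩ := hr.unique hα (k' := .case) h'
    exact .of_reduces (.of_proper (.case₂ h _ _ _)) (hF.plug hD)
  | condI h' => cases (hr.unique hα (k' := .cond) h').1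
  | pairI h' => cases (hr.unique hα (k' := .pair) h').1
  | caseE h' hD _ _ ihE ihF =>
    -- After the permutation the outer cases lie under an additional discharged class; their
    -- weakenings still satisfy `BodyEvaluates`.
    exact .of_reduces (.of_perm (.case h' h _ _ _ _ _))
      (evaluates_caseE_of_isNeutral h' hD (ihE (hE.rename _) (hF.rename _))
        (ihF (hE.rename _) (hF.rename _)))

end Evaluation

/-! ### The fundamental lemma and normalisation -/

/-- Every derivation evaluates under every substitution of values. -/
theorem evaluates_subst (hα : Set.InjOn α S) (hS : SubformulaClosed S) {c c' : List SignedAtom}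
    {J : SignedAtom} (D : Deriv S α Γ Δ c J) (σ : Subst S α Γ Δ c c')
    (hσ : ∀ J x, Value J c' (σ J x)) : Evaluates (D.subst σ) := by
  have hcons : ∀ {c c' c'' : List SignedAtom} {A : SignedAtom} (σ : Subst S α Γ Δ c c')
      (ρ : Ren c' c'') (V : Deriv S α Γ Δ c'' A), (∀ J x, Value J c' (σ J x)) → Value A c'' V →
      ∀ J x, Value J c'' (Subst.cons V (fun J x => (σ J x).rename ρ) J x) := by
    intro c c' c'' A σ ρ V hσ hV J x
    cases x with
    | zero => exact hV
    | succ x => exact (hσ J x).rename ρ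
  -- The induction hypothesis holds for all target contexts and all value substitutions, in
  -- particular for those extended by the value `V`.
  have hbody : ∀ {c c' : List SignedAtom} {A K : SignedAtom} (D : Deriv S α Γ Δ (A :: c) K)
      (σ : Subst S α Γ Δ c c'), (∀ J x, Value J c' (σ J x)) →
      (∀ {c'' : List SignedAtom} (τ : Subst S α Γ Δ (A :: c) c''),
        (∀ J x, Value J c'' (τ J x)) → Evaluates (D.subst τ)) →
      BodyEvaluates (D.subst (σ.lift A)) := by
    intro c c' A K D σ hσ ih c'' ρ V hV
    rw [plug_rename_lift_subst_lift]
    exact ih _ (hcons σ ρ V hσ hV)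
  induction D generalizing c' with
  | premise h => exact (IsNeutral.value ⟨rfl, rfl⟩).evaluates
  | var x => exact (hσ _ x).evaluates
  | topPos => exact (IsNeutral.value ⟨rfl, rfl⟩).evaluates
  | botNeg => exact (IsNeutral.value ⟨rfl, rfl⟩).evaluates
  | pairI h D E ihD ihE =>
    obtain ⟨V, rV, hV⟩ := ihD σ hσ
    obtain ⟨W, rW, hW⟩ := ihE σ hσ
    have hd := h.degree_lt hα hS
    exact ⟨_, rV.pairI h rW, value_iff.2 (.pairI h hd.1 hd.2 hV hW)⟩
  | pairE₁ h D ih =>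
    obtain ⟨V, rV, hV⟩ := ih σ hσ
    exact .of_reduces (rV.pairE₁ h) (hV.evaluates_pairE hα h).1
  | pairE₂ h D ih =>
    obtain ⟨V, rV, hV⟩ := ih σ hσ
    exact .of_reduces (rV.pairE₂ h) (hV.evaluates_pairE hα h).2
  | condI h D ih =>
    have hd := h.degree_lt hα hS
    -- Already a value without any reduction, since its clause only asks that the body evaluate when
    -- values are plugged in.
    exact (value_iff.2 (.condI h hd.1 hd.2 (hbody D σ hσ ih))).evaluates
  | condE h D E ihD ihE =>
    obtain ⟨V, rV, hV⟩ := ihD σ hσ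
    obtain ⟨W, rW, hW⟩ := ihE σ hσ
    exact .of_reduces (rV.condE h rW) (hV.evaluates_condE hα h hW)
  | caseI₁ h D ih =>
    obtain ⟨V, rV, hV⟩ := ih σ hσ
    exact ⟨_, rV.caseI₁ h, value_iff.2 (.caseI₁ h (h.degree_lt hα hS).1 hV)⟩
  | caseI₂ h D ih =>
    obtain ⟨V, rV, hV⟩ := ih σ hσ
    exact ⟨_, rV.caseI₂ h, value_iff.2 (.caseI₂ h (h.degree_lt hα hS).2 hV)⟩
  | caseE h D E F ihD ihE ihF =>
    obtain ⟨V, rV, hV⟩ := ihD σ hσ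
    exact .of_reduces (Reduces.caseE h rV .refl .refl)
      (hV.evaluates_caseE hα h (hbody E σ hσ ihE) (hbody F σ hσ ihF))
  | absurd h D K ih => exact evaluates_absurd h (ih σ hσ)
  | pr h D E K ihD ihE => exact evaluates_pr h (ihD σ hσ) (ihE σ hσ)

theorem exists_reduces_isNormal (hα : Set.InjOn α S) (hS : SubformulaClosed S)
    {c : List SignedAtom} {J : SignedAtom} (D : Deriv S α Γ Δ c J) :
    ∃ D', Reduces D D' ∧ D'.IsNormal := by
  -- Variables are neutral, hence values, so the identity substitution is admissible.
  have h := evaluates_subst hα hS D (fun _ x => var x) fun _ x => (isNeutral_var x).value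
  rw [subst_var] at h
  obtain ⟨D', r, n⟩ := h.exists_reduces
  exact ⟨D', r, isNormal_of_maximalSegments_eq_nil n⟩

end BPR

theorem mainTheorem8 (Θ : Set BPR.Formula) (α : BPR.Formula → BPR.Atom)
    (hα : BPR.IsAtomicMapping (BPR.Sub Θ) α) (Γ Δ : Set BPR.Atom) (J : BPR.SignedAtom)
    (D : BPR.Deriv (BPR.Sub Θ) α Γ Δ [] J) :
    ∃ D' : BPR.Deriv (BPR.Sub Θ) α Γ Δ [] J, BPR.Reduces D D' ∧ D'.IsNormal :=
  BPR.exists_reduces_isNormal hα.injOn (BPR.subformulaClosed_Sub Θ) D
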